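/- Let $H$ be an infinite-dimensional separable complex Hilbert space, let $\mathbf a[\cdot,\cdot]$ be a closed Hermitian sesquilinear form with domain $H^1$ dense in $H$ that is strictly positive, i.e. $\mathbf a[u,u]\ge c\|u\|^2$ for all $u\in H^1$ with some $c>0$, and regard $H^1$ as a Hilbert space with inner product $\mathbf a[\cdot,\cdot]$. Let $H_0^1$ be a closed subspace of $H^1$ which is dense in $H$. Let $A_{\mathrm N}$ and $A_{\mathrm D}$ be the self-adjoint operators in $H$ generated by $\mathbf a$ and by the restriction of $\mathbf a$ to $H_0^1$, respectively. For $\mathrm B=\mathrm N,\mathrm D$ let $N_{\mathrm B}(\lambda)=\dim\chi_{(-\infty,\lambda)}(A_{\mathrm B})H\in\{0,1,2,\dots,\infty\}$, where $\chi_\Lambda(\cdot)$ denotes the spectral projection corresponding to $\Lambda\subset\mathbb R$, and let $\lambda_{\mathrm D,\infty}=\inf\sigma_{\mathrm{ess}}(A_{\mathrm D})$ (equal to $+\infty$ if $\sigma_{\mathrm{ess}}(A_{\mathrm D})=\varnothing$). Let $\lambda\in\mathbb R$ satisfy $\lambda<\lambda_{\mathrm D,\infty}$ and $\lambda\notin\sigma(A_{\mathrm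 N})\cup\sigma(A_{\mathrm D})$. Then the bounded operator $$R'(\lambda)=(A_{\mathrm N}-\lambda I)^{-1}-(A_{\mathrm D}-\lambda I)^{-1}$$ in $H$ is self-adjoint, $N_{\mathrm D}(\lambda)<\infty$, and $$\dim\chi_{(-\infty,0)}(R'(\lambda))H=N_{\mathrm N}(\lambda)-N_{\mathrm D}(\lambda),$$ where both sides may be infinite. In particular, if $N_{\mathrm N}(\lambda)<\infty$, then the number of negative eigenvalues of $R'(\lambda)$, counted with multiplicities, equals $N_{\mathrm N}(\lambda)-N_{\mathrm D}(\lambda)$. -/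

import Mathlib

open Filter Topology
open scoped InnerProductSpace

noncomputable section

namespace FormOperator

variable {H : Type*} [NormedAddCommGroup H] [InnerProductSpace ℂ H]

/-- A densely defined, closed, strictly positive Hermitian sesquilinear form in `H`.
As for Mathlib's inner product, the first variable is the conjugate-linear one. -/
structure ClosedPositiveForm (H : Type*) [NormedAddCommGroup H] [InnerProductSpace ℂ H] where
  /-- The form domain `H¹`. -/
  domain : Submodule ℂ H
  /-- The sesquilinear form `a[·,·]` on `H¹`. -/
  form : domain →ₗ⋆[ℂ] domain →ₗ[ℂ] ℂ
  dense_domain : Dense (domain : Set H)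
  hermitian : ∀ u v, form u v = starRingEnd ℂ (form v u)
  pos : ∃ c : ℝ, 0 < c ∧ ∀ u : domain, c * ‖(u : H)‖ ^ 2 ≤ (form u u).re
  closed : ∀ (u : ℕ → domain) (x : H),
    Tendsto (fun n => (u n : H)) atTop (𝓝 x) →
    (∀ ε : ℝ, 0 < ε → ∃ N, ∀ m ≥ N, ∀ n ≥ N, (form (u m - u n) (u m - u n)).re < ε) →
    ∃ y : domain, (y : H) = x ∧
      Tendsto (fun n => (form (u n - y) (u n - y)).re) atTop (𝓝 0)

namespace ClosedPositiveForm

/-- A subspace `H₀ ⊆ H¹` is closed for the norm `a[u]^{1/2}` of `H¹`. -/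
def IsFormClosed (a : ClosedPositiveForm H) (H₀ : Submodule ℂ H) : Prop :=
  ∀ (u : ℕ → a.domain) (y : a.domain), (∀ n, (u n : H) ∈ H₀) →
    Tendsto (fun n => (a.form (u n - y) (u n - y)).re) atTop (𝓝 0) → (y : H) ∈ H₀

/-- The restriction of the sesquilinear form `a[·,·]` to `H₀ ⊆ H¹`. -/
def restrictForm (a : ClosedPositiveForm H) (H₀ : Submodule ℂ H) (hle : H₀ ≤ a.domain) :
    H₀ →ₗ⋆[ℂ] H₀ →ₗ[ℂ] ℂ :=
  LinearMap.mk₂'ₛₗ (starRingEnd ℂ) (RingHom.id ℂ)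
    (fun u v => a.form (Submodule.inclusion hle u) (Submodule.inclusion hle v))
    (fun _ _ _ => by simp) (fun _ _ _ => by simp) (fun _ _ _ => by simp) (fun _ _ _ => by simp)

/-- The restriction of the form `a` to a subspace `H₀ ⊆ H¹` which is dense in `H` and closed
in `H¹`; it is again a densely defined closed strictly positive form. -/
def restrict (a : ClosedPositiveForm H) (H₀ : Submodule ℂ H) (hle : H₀ ≤ a.domain)
    (hdense : Dense (H₀ : Set H)) (hclosed : a.IsFormClosed H₀) : ClosedPositiveForm H where
  domain := H₀
  form := a.restrictForm H₀ hle
  dense_domain := hdense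
  hermitian u v := a.hermitian _ _
  pos := by
    obtain ⟨c, hc, h⟩ := a.pos
    exact ⟨c, hc, fun u => h (Submodule.inclusion hle u)⟩
  closed u x hx hu := by
    obtain ⟨y, hy, hlim⟩ := a.closed (fun n => Submodule.inclusion hle (u n)) x hx hu
    exact ⟨⟨(y : H), hclosed _ y (fun n => (u n).2) hlim⟩, hy, hlim⟩

/-- The graph of the operator generated by `a`: the pairs `(u, f)` with `u ∈ H¹` and
`a[v, u] = (v, f)` for all `v ∈ H¹`. -/
def operatorGraph (a : ClosedPositiveForm H) : Submodule ℂ (H × H) where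
  carrier := {p | ∃ u : a.domain, (u : H) = p.1 ∧ ∀ v : a.domain, a.form v u = ⟪(v : H), p.2⟫_ℂ}
  zero_mem' := ⟨0, by simp⟩
  add_mem' := by
    rintro p q ⟨u, hu, hu'⟩ ⟨w, hw, hw'⟩
    exact ⟨u + w, by simp [hu, hw], fun v => by simp [hu', hw']⟩
  smul_mem' := by
    rintro c p ⟨u, hu, hu'⟩
    exact ⟨c • u, by simp [hu], fun v => by simp [hu']⟩

/-- The self-adjoint operator in `H` generated by the form `a`. Its graph is a graph of a
function because `H¹` is dense in `H`. -/
def operator (a : ClosedPositiveForm H) : H →ₗ.[ℂ] H :=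
  a.operatorGraph.toLinearPMap

end ClosedPositiveForm

/-- The bounded operator `R` is the inverse of `A - z : D(A) → H`. -/
def IsResolventAt (A : H →ₗ.[ℂ] H) (z : ℂ) (R : H →L[ℂ] H) : Prop :=
  (∀ f : H, ∃ u : A.domain, (u : H) = R f ∧ A u - z • (u : H) = f) ∧
    ∀ u : A.domain, R (A u - z • (u : H)) = u

/-- The spectrum of an unbounded operator. -/
def opSpectrum (A : H →ₗ.[ℂ] H) : Set ℂ :=
  {z | ¬ ∃ R : H →L[ℂ] H, IsResolventAt A z R}

open Classical in
/-- The resolvent `(A - z)⁻¹`, for `z` outside the spectrum of `A` (and `0` otherwise). -/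
def opResolvent (A : H →ₗ.[ℂ] H) (z : ℂ) : H →L[ℂ] H :=
  if h : ∃ R : H →L[ℂ] H, IsResolventAt A z R then h.choose else 0

/-- The dimension of a subspace, as an element of `ℕ ∪ {∞}`. -/
def edim (M : Submodule ℂ H) : ℕ∞ :=
  Cardinal.toENat (Module.rank ℂ M)

/-- The number of negative eigenvalues of a self-adjoint operator `T`, counted with their
multiplicities (eigenspaces of different eigenvalues being linearly independent). -/
def negEigenvalueCount (T : H →L[ℂ] H) : ℕ∞ :=
  edim (⨆ (μ : ℝ) (_ : μ < 0), Module.End.eigenspace (T : H →ₗ[ℂ] H) (μ : ℂ))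

variable [CompleteSpace H]

/-- The range `χ_U(T)H` of the spectral projection of a bounded self-adjoint operator `T`
corresponding to an open set `U ⊆ ℝ`. Since `χ_U` is the supremum of the continuous functions
`0 ≤ f ≤ 1` vanishing outside `U`, this is the closed linear span of the ranges of all `f(T)`
with `f` continuous and vanishing outside `U`. -/
def spectralSubspace (T : H →L[ℂ] H) (U : Set ℝ) : Submodule ℂ H :=
  (⨆ (f : ℝ → ℝ) (_ : Continuous f) (_ : ∀ t, t ∉ U → f t = 0),
    LinearMap.range ((cfc f T : H →L[ℂ] H) : H →ₗ[ℂ] H)).topologicalClosure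

/-- The range `χ_Λ(A)H` of the spectral projection, corresponding to an open set `Λ ⊆ ℝ`, of an
unbounded self-adjoint operator `A` with a bounded inverse:
`χ_Λ(A) = χ_{Λ'}(A⁻¹)` with `Λ' = {s ≠ 0 : s⁻¹ ∈ Λ}`. -/
def opSpectralSubspace (A : H →ₗ.[ℂ] H) (Λ : Set ℝ) : Submodule ℂ H :=
  spectralSubspace (opResolvent A 0) {s | s ≠ 0 ∧ s⁻¹ ∈ Λ}

/-- The counting function `N(lam) = dim χ_{(-∞,lam)}(A)H`. -/
def countingFunction (A : H →ₗ.[ℂ] H) (lam : ℝ) : ℕ∞ :=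
  edim (opSpectralSubspace A (Set.Iio lam))

/-- The essential spectrum of a self-adjoint operator: the points `μ` such that the spectral
subspace of every neighbourhood of `μ` is infinite dimensional. -/
def essSpectrum (A : H →ₗ.[ℂ] H) : Set ℝ :=
  {μ | ∀ ε : ℝ, 0 < ε → edim (opSpectralSubspace A (Set.Ioo (μ - ε) (μ + ε))) = ⊤}

/-- `inf σ_ess(A)`, equal to `+∞` if the essential spectrum is empty. -/
def essInf (A : H →ₗ.[ℂ] H) : EReal :=
  sInf ((fun μ : ℝ => (μ : EReal)) '' essSpectrum A)

/-- The dimension of the spectral subspace `χ_{(-∞,0)}(T)H` of a bounded self-adjoint `T`. -/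
def negativeDim (T : H →L[ℂ] H) : ℕ∞ :=
  edim (spectralSubspace T (Set.Iio 0))

end FormOperator

end

/-! Everything is read off one Hermitian form. Let `V` be the form domain with inner product `a`, `J
: V → H` its embedding, `K ⊆ V` the smaller form domain and `P` the orthogonal projection onto `K`.
Then the inverses of the two operators are the bounded operators `J J*` and `J P J*`, and the form
`a - lam` on `V` is that of `Q = 1 - lam J*J`.

By Glazman's lemma a counting function is the largest dimension of a subspace on which a form is
negative definite. For `T = J P J*` the form of `T - lam T²` is the form of `Q` pulled back along `P
J*`, whose range is dense in `K`. Negative definite subspaces survive small perturbations, so the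
count is the negative index of `Q` on `K`, and on `V` when `P = 1`.

Since `lam` is not in the Dirichlet spectrum, `V` is the direct sum of `K` and its `Q`-orthogonal
complement `G`, and negative indices add: the index on `V` is that on `K` plus that on `G`. The
difference of the resolvents, lifted to a map `S : H → V`, takes values in `G` with dense range, and
`Q[S x] = (R' x, x)`. Hence the index on `G` is the negative dimension of `R'`.

The carrying lemmas are `natCast_le_edim_spectralSubspace_iff`, `HasNegDim.of_le_closure`,
`HasNegDim.sub` and `hasNegDim_resolvent_sub_iff`. Finiteness of the Dirichlet count comes from
compactness of `[0, lam]`. -/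

namespace FormOperator

/-! ### Negative index of a Hermitian form -/

section NegativeIndex

variable {V : Type*} [NormedAddCommGroup V] [InnerProductSpace ℂ V]

/-- The quadratic form of `Q` is negative definite on some `n`-dimensional subspace of `W`. -/
def HasNegDim (Q : V →L[ℂ] V) (W : Submodule ℂ V) (n : ℕ) : Prop :=
  ∃ L : (Fin n → ℂ) →ₗ[ℂ] V, (∀ c, L c ∈ W) ∧ ∀ c ≠ 0, (⟪Q (L c), L c⟫_ℂ).re < 0

theorem HasNegDim.of_linearMap {Q : V →L[ℂ] V} {W : Submodule ℂ V} {n : ℕ}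
    {M : Type*} [AddCommGroup M] [Module ℂ M] [FiniteDimensional ℂ M] (L : M →ₗ[ℂ] V)
    (hW : ∀ c, L c ∈ W) (hneg : ∀ c ≠ 0, (⟪Q (L c), L c⟫_ℂ).re < 0)
    (hn : n ≤ Module.finrank ℂ M) : HasNegDim Q W n := by
  obtain ⟨f, hf⟩ : ∃ f : (Fin n → ℂ) →ₗ[ℂ] M, Function.Injective f := by
    rw [← Module.le_rank_iff_exists_linearMap, ← Module.finrank_eq_rank]
    exact_mod_cast hn
  refine ⟨L ∘ₗ f, fun c => hW _, fun c hc => hneg _ ?_⟩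
  rwa [Ne, map_eq_zero_iff f hf]

theorem HasNegDim.mono {Q : V →L[ℂ] V} {W : Submodule ℂ V} {m n : ℕ} (h : HasNegDim Q W n)
    (hmn : m ≤ n) : HasNegDim Q W m := by
  obtain ⟨L, hW, hL⟩ := h
  exact .of_linearMap L hW hL (by simpa using hmn)

/-- The quadratic form of `Q` on a sum of two `Q`-orthogonal vectors. -/
theorem re_inner_add_of_orthogonal {Q : V →L[ℂ] V} (hQ : (Q : V →ₗ[ℂ] V).IsSymmetric) {u v : V}
    (h : ⟪u, Q v⟫_ℂ = 0) :
    (⟪Q (u + v), u + v⟫_ℂ).re = (⟪Q u, u⟫_ℂ).re + (⟪Q v, v⟫_ℂ).re := by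
  have h1 : ⟪Q u, v⟫_ℂ = 0 := (hQ u v).trans h
  have h2 : ⟪Q v, u⟫_ℂ = 0 := by rw [← inner_conj_symm, h, map_zero]
  rw [map_add, inner_add_left, inner_add_right, inner_add_right, h1, h2]
  simp

theorem HasNegDim.add {Q : V →L[ℂ] V} (hQ : (Q : V →ₗ[ℂ] V).IsSymmetric)
    {V₀ G W : Submodule ℂ V} {m n : ℕ} (h₀ : HasNegDim Q V₀ m) (hG : HasNegDim Q G n)
    (hV₀W : V₀ ≤ W) (hGW : G ≤ W) (horth : ∀ v ∈ V₀, ∀ g ∈ G, ⟪v, Q g⟫_ℂ = 0) :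
    HasNegDim Q W (m + n) := by
  obtain ⟨L, hL, hLneg⟩ := h₀
  obtain ⟨K, hK, hKneg⟩ := hG
  refine .of_linearMap (L.coprod K) (fun c => W.add_mem (hV₀W (hL _)) (hGW (hK _))) ?_ (by simp)
  rintro ⟨c, d⟩ hcd
  rw [LinearMap.coprod_apply, re_inner_add_of_orthogonal hQ (horth _ (hL _) _ (hK _))]
  by_cases hc : c = 0
  · have hd : d ≠ 0 := by rintro rfl; exact hcd (by simp [hc])
    simpa [hc] using hKneg d hd
  · by_cases hd : d = 0
    · simpa [hd] using hLneg c hc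
    · exact add_neg (hLneg c hc) (hKneg d hd)

/-- If the maximal dimension of a negative definite subspace of `V₀` is `m`, then a negative
definite subspace of `V₀ + G` of dimension `k` yields one of `G` of dimension `k - m`. -/
theorem HasNegDim.sub {Q : V →L[ℂ] V} (hQ : (Q : V →ₗ[ℂ] V).IsSymmetric)
    {V₀ G : Submodule ℂ V} {m k : ℕ} (h₀ : HasNegDim Q V₀ m) (h₀' : ¬ HasNegDim Q V₀ (m + 1))
    (p : V →ₗ[ℂ] V) (hpG : ∀ u, p u ∈ G) (hpV₀ : ∀ u, u - p u ∈ V₀)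
    (horth : ∀ v ∈ V₀, ∀ g ∈ G, ⟪v, Q g⟫_ℂ = 0) (h : HasNegDim Q ⊤ k) :
    HasNegDim Q G (k - m) := by
  obtain ⟨L, hL, hLneg⟩ := h₀
  obtain ⟨K, -, hKneg⟩ := h
  -- `φ x = 0` means that `x` is `Q`-orthogonal to the range of `L`. These are `m` conditions, so at
  -- least `k - m` dimensions of the range of `K` satisfy them.
  let φ : V →ₗ[ℂ] (Fin m → ℂ) :=
    LinearMap.pi fun i => ((innerSL ℂ (L (Pi.single i 1))) ∘L Q : V →L[ℂ] ℂ).toLinearMap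
  have hφ : ∀ x, φ x = 0 → ∀ c, ⟪L c, Q x⟫_ℂ = 0 := by
    intro x hx c
    have hc : L c = ∑ i, c i • L (Pi.single i 1) := by
      conv_lhs => rw [pi_eq_sum_univ' c]
      simp only [map_sum, map_smul]
    rw [hc, sum_inner]
    refine Finset.sum_eq_zero fun i _ => ?_
    have := congrFun hx i
    rw [inner_smul_left]
    simpa [φ] using Or.inr this
  refine .of_linearMap (p ∘ₗ K ∘ₗ (LinearMap.ker (φ ∘ₗ K)).subtype) (fun c => hpG _) ?_ ?_
  · rintro ⟨c, hc⟩ hc0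
    have hc0' : c ≠ 0 := fun h => hc0 (by simpa using h)
    simp only [LinearMap.coe_comp, Function.comp_apply, Submodule.subtype_apply]
    set x := K c
    have hsplit := re_inner_add_of_orthogonal hQ (horth _ (hpV₀ x) _ (hpG x))
    rw [sub_add_cancel] at hsplit
    -- Both `x` and `p x` are `Q`-orthogonal to the range of `L`. Were `x - p x` negative, adjoining
    -- it to that range would give `m + 1` negative dimensions in `V₀`.
    have hpos : 0 ≤ (⟪Q (x - p x), x - p x⟫_ℂ).re := by
      by_contra! hlt
      apply h₀'
      refine HasNegDim.add hQ (V₀ := LinearMap.range L) (G := ℂ ∙ (x - p x))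
        ⟨L, fun c => ⟨c, rfl⟩, hLneg⟩ ?_ ?_ ?_ ?_
      · refine .of_linearMap (M := ℂ) (LinearMap.toSpanSingleton ℂ V (x - p x)) ?_ ?_ (by simp)
        · exact fun c => Submodule.mem_span_singleton.2 ⟨c, rfl⟩
        · intro c hc
          simp only [LinearMap.toSpanSingleton_apply, map_smul, inner_smul_left, inner_smul_right]
          rw [← mul_assoc, Complex.mul_conj, Complex.re_ofReal_mul]
          exact mul_neg_of_pos_of_neg (Complex.normSq_pos.2 hc) hlt
      · rintro _ ⟨c, rfl⟩; exact hL c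
      · exact (Submodule.span_singleton_le_iff_mem _ _).2 (hpV₀ x)
      · rintro _ ⟨d, rfl⟩ g hg
        obtain ⟨e, rfl⟩ := Submodule.mem_span_singleton.1 hg
        have h1 := hφ x hc d
        have h2 := horth _ (hL d) _ (hpG x)
        rw [map_smul, inner_smul_right, map_sub, inner_sub_right, h1, h2]
        simp
    have := hKneg c hc0'
    linarith
  · have h1 := LinearMap.finrank_range_add_finrank_ker (φ ∘ₗ K)
    have h2 := (LinearMap.range (φ ∘ₗ K)).finrank_le
    simp only [Module.finrank_fin_fun] at h1 h2
    omega

/-- Negative definite subspaces can be moved into a dense subspace. -/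
theorem HasNegDim.of_le_closure {Q : V →L[ℂ] V} {D W : Submodule ℂ V}
    (hDW : (W : Set V) ⊆ closure (D : Set V)) {n : ℕ} (h : HasNegDim Q W n) :
    HasNegDim Q D n := by
  obtain ⟨L, hL, hneg⟩ := h
  let F : (Fin n → V) → (Fin n → ℂ) → V := fun v c => ∑ i, c i • v i
  have hF : Continuous fun z : (Fin n → V) × (Fin n → ℂ) =>
      (⟪Q (F z.1 z.2), F z.1 z.2⟫_ℂ).re := by
    have : Continuous fun z : (Fin n → V) × (Fin n → ℂ) => F z.1 z.2 := by
      simp only [F]; fun_prop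
    fun_prop
  let v₀ : Fin n → V := fun i => L (Pi.single i 1)
  have hFL : ∀ c, F v₀ c = L c := by
    intro c
    conv_rhs => rw [pi_eq_sum_univ' c]
    simp only [map_sum, map_smul, F, v₀]
  -- Compactness of the unit sphere makes negativity stable under moving the images of the basis
  -- vectors; homogeneity then extends it to all `c ≠ 0`.
  have hev : ∀ᶠ v in 𝓝 v₀, ∀ c ∈ Metric.sphere (0 : Fin n → ℂ) 1,
      (⟪Q (F v c), F v c⟫_ℂ).re < 0 := by
    refine (isCompact_sphere _ _).eventually_forall_of_forall_eventually fun c hc => ?_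
    refine hF.continuousAt.eventually_lt continuousAt_const ?_
    have hc0 : c ≠ 0 := by rintro rfl; simp at hc
    simpa only [hFL] using hneg c hc0
  have hmem : v₀ ∈ closure (Set.univ.pi fun _ : Fin n => (D : Set V)) := by
    rw [closure_pi_set]
    exact fun i _ => hDW (hL _)
  obtain ⟨v, hv, hvD⟩ := mem_closure_iff_nhds.1 hmem _ hev
  refine ⟨Fintype.linearCombination ℂ v, fun c => ?_, fun c hc => ?_⟩
  · rw [Fintype.linearCombination_apply]
    exact D.sum_mem fun i _ => D.smul_mem _ (hvD i trivial)
  · have hc' : 0 < ‖c‖ := norm_pos_iff.2 hc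
    have h1 := hv ((‖c‖⁻¹ : ℂ) • c) (by simp [norm_smul, hc'.ne'])
    have h2 : F v ((‖c‖⁻¹ : ℂ) • c) = (‖c‖⁻¹ : ℂ) • Fintype.linearCombination ℂ v c := by
      simp [F, Fintype.linearCombination_apply, Finset.smul_sum, smul_smul]
    rw [h2, map_smul, inner_smul_left, inner_smul_right, ← mul_assoc, mul_comm (starRingEnd ℂ _),
      Complex.mul_conj, Complex.re_ofReal_mul] at h1
    exact (pos_iff_neg_of_mul_neg h1).1 (Complex.normSq_pos.2 (by simpa using hc))

/-- Negative definite subspaces of a form pulled back along `S`. -/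
theorem hasNegDim_iff_of_pullback {E : Type*} [NormedAddCommGroup E] [InnerProductSpace ℂ E]
    {Q : V →L[ℂ] V} {T : E →L[ℂ] E} (S : E →L[ℂ] V) {W : Submodule ℂ V}
    (hT : ∀ x, (⟪T x, x⟫_ℂ).re = (⟪Q (S x), S x⟫_ℂ).re) (hSW : ∀ x, S x ∈ W)
    (hWS : (W : Set V) ⊆ closure (Set.range S)) {n : ℕ} :
    HasNegDim T ⊤ n ↔ HasNegDim Q W n := by
  constructor
  · rintro ⟨L, -, hL⟩
    refine ⟨S.toLinearMap ∘ₗ L, fun c => hSW _, fun c hc => ?_⟩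
    have h := hL c hc
    rwa [hT] at h
  · intro h
    obtain ⟨L, hL, hneg⟩ := HasNegDim.of_le_closure (D := LinearMap.range S.toLinearMap) hWS h
    -- `S` need not be injective; a linear lift exists because `Fin n → ℂ` is free.
    obtain ⟨K, hK⟩ := Module.projective_lifting_property S.toLinearMap.rangeRestrict
      (L.codRestrict _ hL) S.toLinearMap.surjective_rangeRestrict
    refine ⟨K, fun _ => trivial, fun c hc => ?_⟩
    have h1 : S (K c) = L c := congrArg Subtype.val (LinearMap.congr_fun hK c)
    rw [hT, h1]
    exact hneg c hc

end NegativeIndex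

/-! ### Spectral subspaces and Glazman's lemma -/

section SpectralSubspace

variable {H : Type*} [NormedAddCommGroup H] [InnerProductSpace ℂ H]

theorem natCast_le_edim_iff {M : Submodule ℂ H} {n : ℕ} :
    (n : ℕ∞) ≤ edim M ↔ ∃ f : (Fin n → ℂ) →ₗ[ℂ] M, Function.Injective f := by
  rw [edim, Cardinal.natCast_le_toENat, Module.le_rank_iff_exists_linearMap]

theorem edim_ne_top_iff {M : Submodule ℂ H} : edim M ≠ ⊤ ↔ FiniteDimensional ℂ M := by
  rw [edim, Ne, Cardinal.toENat_eq_top, not_le]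
  exact Module.rank_lt_aleph0_iff

variable [CompleteSpace H]

theorem cfc_mul_apply (T : H →L[ℂ] H) {f g : ℝ → ℝ} (hf : Continuous f) (hg : Continuous g)
    (x : H) : cfc (fun t => f t * g t) T x = cfc f T (cfc g T x) := by
  rw [cfc_mul f g T hf.continuousOn hg.continuousOn]
  rfl

theorem inner_cfc_apply (T : H →L[ℂ] H) (f : ℝ → ℝ) (x y : H) :
    ⟪cfc f T x, y⟫_ℂ = ⟪x, cfc f T y⟫_ℂ :=
  ContinuousLinearMap.isSelfAdjoint_iff_isSymmetric.1 (cfc_predicate f T) x y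

/-- On the spectrum `g` lies in the closed ideal generated by `f`, so `ker f(T) ⊆ ker g(T)`. -/
theorem cfc_apply_eq_zero {T : H →L[ℂ] H} {f g : ℝ → ℝ} (hf : Continuous f) (hg : Continuous g)
    (hfg : ∀ t ∈ spectrum ℝ T, g t ≠ 0 → f t ≠ 0) {x : H} (hx : cfc f T x = 0) :
    cfc g T x = 0 := by
  have key : ∀ ε > 0, ‖cfc g T x‖ ≤ ε * ‖x‖ := by
    intro ε hε
    obtain ⟨δ, hδ, hδf⟩ : ∃ δ > 0, ∀ t ∈ spectrum ℝ T, ε ≤ |g t| → δ ≤ f t ^ 2 := by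
      have hK : IsCompact (spectrum ℝ T ∩ {t | ε ≤ |g t|}) :=
        (spectrum.isCompact T).inter_right (isClosed_le continuous_const hg.abs)
      rcases (spectrum ℝ T ∩ {t | ε ≤ |g t|}).eq_empty_or_nonempty with h | h
      · exact ⟨1, one_pos, fun t ht h' => absurd (h ▸ ⟨ht, h'⟩ : t ∈ (∅ : Set ℝ)) (by simp)⟩
      · obtain ⟨t₀, ⟨ht₀, ht₀'⟩, hmin⟩ := hK.exists_isMinOn h (f := fun t => f t ^ 2)
          (by fun_prop)
        have hg0 : g t₀ ≠ 0 := abs_pos.1 (hε.trans_le ht₀')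
        exact ⟨f t₀ ^ 2, by have := hfg t₀ ht₀ hg0; positivity, fun t ht h' => hmin ⟨ht, h'⟩⟩
    -- `m` clips `g` to `[-ε, ε]`. Where `g - m` is nonzero on the spectrum, `f² ≥ δ`, so there `g -
    -- m = k f` with `k` continuous; thus `g(T) x = m(T) x`, of norm at most `ε ‖x‖`.
    let m : ℝ → ℝ := fun t => max (-ε) (min ε (g t))
    let k : ℝ → ℝ := fun t => f t * (g t - m t) / max (f t ^ 2) δ
    have hm : Continuous m := by fun_prop
    have hpos : ∀ t, 0 < max (f t ^ 2) δ := fun t => lt_max_of_lt_right hδ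
    have hk : Continuous k :=
      (hf.mul (hg.sub hm)).div ((hf.pow 2).max continuous_const) fun t => (hpos t).ne'
    have heq : cfc (fun t => g t - m t) T = cfc (fun t => k t * f t) T := by
      refine cfc_congr fun t ht => ?_
      simp only [k]
      by_cases h : ε ≤ |g t|
      · rw [max_eq_left (hδf t ht h)]
        have : f t ≠ 0 := hfg t ht (abs_pos.1 (hε.trans_le h))
        field_simp
      · have h' := abs_lt.1 (not_le.1 h)
        have : g t - m t = 0 := by
          simp only [m]
          rw [min_eq_right h'.2.le, max_eq_right h'.1.le, sub_self]
        simp [this]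
    have h0 : cfc (fun t => g t - m t) T x = 0 := by
      rw [heq, cfc_mul_apply T hk hf, hx, map_zero]
    rw [cfc_sub g m T hg.continuousOn hm.continuousOn, sub_apply,
      sub_eq_zero] at h0
    rw [h0]
    refine (cfc m T).le_of_opNorm_le (norm_cfc_le hε.le fun t _ => ?_) x
    rw [Real.norm_eq_abs, abs_le]
    exact ⟨le_max_left _ _, max_le (by linarith) (min_le_left _ _)⟩
  rw [← norm_le_zero_iff]
  refine le_of_forall_pos_le_add fun ε hε => ?_
  refine (key (ε / (‖x‖ + 1)) (by positivity)).trans ?_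
  rw [div_mul_eq_mul_div, zero_add, div_le_iff₀ (by positivity)]
  nlinarith [norm_nonneg x]

theorem range_cfc_le_spectralSubspace (T : H →L[ℂ] H) {U : Set ℝ} {f : ℝ → ℝ} (hf : Continuous f)
    (hfU : ∀ t, t ∉ U → f t = 0) :
    LinearMap.range ((cfc f T : H →L[ℂ] H) : H →ₗ[ℂ] H) ≤ spectralSubspace T U := by
  refine le_trans (le_iSup_of_le f ?_) (Submodule.le_topologicalClosure _)
  rw [iSup_pos hf, iSup_pos hfU]

theorem mem_spectralSubspace_orthogonal_iff {T : H →L[ℂ] H} {U : Set ℝ} {x : H} :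
    x ∈ (spectralSubspace T U)ᗮ ↔
      ∀ f : ℝ → ℝ, Continuous f → (∀ t, t ∉ U → f t = 0) → cfc f T x = 0 := by
  constructor
  · intro hx f hf hfU
    rw [← inner_self_eq_zero (𝕜 := ℂ), ← inner_cfc_apply]
    exact hx _ (range_cfc_le_spectralSubspace T hf hfU ⟨_, rfl⟩)
  · intro h
    rw [spectralSubspace, Submodule.orthogonal_closure, Submodule.mem_orthogonal']
    have hle : (⨆ (f : ℝ → ℝ) (_ : Continuous f) (_ : ∀ t, t ∉ U → f t = 0),
        LinearMap.range ((cfc f T : H →L[ℂ] H) : H →ₗ[ℂ] H)) ≤ (ℂ ∙ x)ᗮ := by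
      refine iSup_le fun f => iSup₂_le fun hf hfU => ?_
      rintro _ ⟨y, rfl⟩
      rw [Submodule.mem_orthogonal_singleton_iff_inner_left]
      exact (inner_cfc_apply T f y x).trans (by rw [h f hf hfU, inner_zero_right])
    exact fun u hu => Submodule.mem_orthogonal_singleton_iff_inner_right.1 (hle hu)

/-- A single function with nonvanishing set `U` suffices: its kernel is contained in the kernel of
every other admissible function. -/
theorem spectralSubspace_orthogonal {T : H →L[ℂ] H} {U : Set ℝ} {f : ℝ → ℝ} (hf : Continuous f)
    (hfU : ∀ t, f t ≠ 0 ↔ t ∈ U) {x : H} :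
    x ∈ (spectralSubspace T U)ᗮ ↔ cfc f T x = 0 := by
  rw [mem_spectralSubspace_orthogonal_iff]
  constructor
  · exact fun h => h f hf fun t ht => by_contra fun h' => ht ((hfU t).1 h')
  · exact fun hx g hg hgU => cfc_apply_eq_zero hf hg
      (fun t _ hgt => (hfU t).2 (by_contra fun h => hgt (hgU t h))) hx

theorem isClosed_spectralSubspace (T : H →L[ℂ] H) (U : Set ℝ) :
    IsClosed (spectralSubspace T U : Set H) :=
  Submodule.isClosed_topologicalClosure _

instance (T : H →L[ℂ] H) (U : Set ℝ) : CompleteSpace (spectralSubspace T U) :=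
  (isClosed_spectralSubspace T U).completeSpace_coe

theorem mem_spectralSubspace_iff {T : H →L[ℂ] H} {U : Set ℝ} {f : ℝ → ℝ} (hf : Continuous f)
    (hfU : ∀ t, f t ≠ 0 ↔ t ∈ U) {x : H} :
    x ∈ spectralSubspace T U ↔ ∀ y, cfc f T y = 0 → ⟪y, x⟫_ℂ = 0 := by
  rw [← Submodule.orthogonal_orthogonal (spectralSubspace T U), Submodule.mem_orthogonal]
  simp only [spectralSubspace_orthogonal hf hfU]

theorem cfc_eq_sqrt_sub_sqrt (T : H →L[ℂ] H) {f : ℝ → ℝ} (hf : Continuous f) (x : H) :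
    cfc f T x = cfc (fun t => √(f t)) T (cfc (fun t => √(f t)) T x)
      - cfc (fun t => √(-f t)) T (cfc (fun t => √(-f t)) T x) := by
  have hp : Continuous fun t => √(f t) := by fun_prop
  have hr : Continuous fun t => √(-f t) := by fun_prop
  rw [← cfc_mul_apply T hp hp, ← cfc_mul_apply T hr hr, ← sub_apply,
    ← cfc_sub _ _ T (by fun_prop) (by fun_prop)]
  congr 2
  ext t
  rcases le_total 0 (f t) with h | h
  · rw [Real.mul_self_sqrt h, Real.sqrt_eq_zero_of_nonpos (by linarith : -f t ≤ 0)]; ring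
  · rw [Real.mul_self_sqrt (by linarith : 0 ≤ -f t), Real.sqrt_eq_zero_of_nonpos h]; ring

theorem cfc_sqrt_neg_cfc_sqrt (T : H →L[ℂ] H) {f : ℝ → ℝ} (hf : Continuous f) (x : H) :
    cfc (fun t => √(-f t)) T (cfc (fun t => √(f t)) T x) = 0 := by
  rw [← cfc_mul_apply T (by fun_prop) (by fun_prop)]
  have : (fun t => √(-f t) * √(f t)) = fun _ => 0 := by
    ext t
    rcases le_total 0 (f t) with h | h
    · rw [Real.sqrt_eq_zero_of_nonpos (by linarith : -f t ≤ 0), zero_mul]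
    · rw [Real.sqrt_eq_zero_of_nonpos h, mul_zero]
  rw [this, cfc_const_zero]
  rfl

theorem re_inner_cfc (T : H →L[ℂ] H) {f : ℝ → ℝ} (hf : Continuous f) (x : H) :
    (⟪cfc f T x, x⟫_ℂ).re =
      ‖cfc (fun t => √(f t)) T x‖ ^ 2 - ‖cfc (fun t => √(-f t)) T x‖ ^ 2 := by
  rw [cfc_eq_sqrt_sub_sqrt T hf, inner_sub_left, inner_cfc_apply, inner_cfc_apply _ _ _ x,
    inner_self_eq_norm_sq_to_K, inner_self_eq_norm_sq_to_K]
  norm_cast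

theorem sqrt_neg_ne_zero_iff (f : ℝ → ℝ) (t : ℝ) : √(-f t) ≠ 0 ↔ t ∈ {t | f t < 0} := by
  rw [Real.sqrt_ne_zero', Set.mem_ofPred_eq, neg_pos]

/-- The product of `√f` and `√(-f)` vanishes, so the range of `√f(T)` lies in the kernel of
`√(-f)(T)`, which is orthogonal to the spectral subspace. -/
theorem cfc_sqrt_eq_zero_of_mem {T : H →L[ℂ] H} {f : ℝ → ℝ} (hf : Continuous f) {x : H}
    (hx : x ∈ spectralSubspace T {t | f t < 0}) : cfc (fun t => √(f t)) T x = 0 := by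
  rw [mem_spectralSubspace_iff (by fun_prop) (sqrt_neg_ne_zero_iff f)] at hx
  have := hx _ (cfc_sqrt_neg_cfc_sqrt T hf (cfc (fun t => √(f t)) T x))
  rwa [inner_cfc_apply, inner_self_eq_zero] at this

theorem re_inner_cfc_neg_of_mem {T : H →L[ℂ] H} {f : ℝ → ℝ} (hf : Continuous f) {x : H}
    (hx : x ∈ spectralSubspace T {t | f t < 0}) (hx0 : x ≠ 0) : (⟪cfc f T x, x⟫_ℂ).re < 0 := by
  rw [re_inner_cfc T hf, cfc_sqrt_eq_zero_of_mem hf hx]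
  have : cfc (fun t => √(-f t)) T x ≠ 0 := by
    intro h
    rw [← spectralSubspace_orthogonal (by fun_prop) (sqrt_neg_ne_zero_iff f)] at h
    exact hx0 (inner_self_eq_zero.1 (h x hx))
  have := norm_pos_iff.2 this
  simp only [norm_zero]
  nlinarith

theorem re_inner_cfc_nonneg_of_mem_orthogonal {T : H →L[ℂ] H} {f : ℝ → ℝ} (hf : Continuous f)
    {x : H} (hx : x ∈ (spectralSubspace T {t | f t < 0})ᗮ) : 0 ≤ (⟪cfc f T x, x⟫_ℂ).re := by
  rw [spectralSubspace_orthogonal (by fun_prop) (sqrt_neg_ne_zero_iff f)] at hx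
  rw [re_inner_cfc T hf, hx]
  simp

/-- Glazman's lemma: the dimension of the spectral subspace of `{f < 0}` is the maximal dimension
of a subspace on which the quadratic form of `f(T)` is negative definite. -/
theorem natCast_le_edim_spectralSubspace_iff {T : H →L[ℂ] H} {f : ℝ → ℝ} (hf : Continuous f)
    {n : ℕ} : (n : ℕ∞) ≤ edim (spectralSubspace T {t | f t < 0}) ↔ HasNegDim (cfc f T) ⊤ n := by
  rw [natCast_le_edim_iff]
  constructor
  · rintro ⟨L, hL⟩
    refine ⟨Submodule.subtype _ ∘ₗ L, fun _ => trivial, fun c hc => ?_⟩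
    refine re_inner_cfc_neg_of_mem hf (L c).2 ?_
    simpa [map_eq_zero_iff L hL] using hc
  · rintro ⟨L, -, hL⟩
    set E := spectralSubspace T {t | f t < 0}
    -- Projecting to `E` loses no dimension: the kernel is `Eᗮ`, where the form is nonnegative.
    refine ⟨E.orthogonalProjectionOnto.toLinearMap ∘ₗ L, ?_⟩
    rw [injective_iff_map_eq_zero]
    intro c hc
    by_contra hc0
    have hmem : L c ∈ Eᗮ := Submodule.orthogonalProjectionOnto_eq_zero_iff.1 hc
    exact (hL c hc0).not_ge (re_inner_cfc_nonneg_of_mem_orthogonal hf hmem)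

theorem natCast_le_negativeDim_iff {T : H →L[ℂ] H} (hT : IsSelfAdjoint T) {n : ℕ} :
    (n : ℕ∞) ≤ negativeDim T ↔ HasNegDim T ⊤ n := by
  have := natCast_le_edim_spectralSubspace_iff (T := T) (f := id) continuous_id (n := n)
  rwa [cfc_id ℝ T hT] at this

theorem setOf_inv_lt_eq (lam : ℝ) :
    {s : ℝ | s ≠ 0 ∧ s⁻¹ ∈ Set.Iio lam} = {s | s - lam * s ^ 2 < 0} := by
  ext s
  simp only [Set.mem_ofPred_eq, Set.mem_Iio]
  by_cases hs : s = 0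
  · simp [hs]
  · have h2 : 0 < s ^ 2 := by positivity
    have : s - lam * s ^ 2 = s ^ 2 * (s⁻¹ - lam) := by field_simp
    rw [this, ← sub_neg (a := s⁻¹)]
    exact ⟨fun h => mul_neg_of_pos_of_neg h2 h.2, fun h => ⟨hs, (pos_iff_neg_of_mul_neg h).1 h2⟩⟩

theorem natCast_le_edim_spectralSubspace_inv_iff {T : H →L[ℂ] H} (hT : IsSelfAdjoint T)
    (lam : ℝ) {n : ℕ} :
    (n : ℕ∞) ≤ edim (spectralSubspace T {s | s ≠ 0 ∧ s⁻¹ ∈ Set.Iio lam}) ↔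
      HasNegDim (T - (lam : ℂ) • (T * T)) ⊤ n := by
  rw [setOf_inv_lt_eq, natCast_le_edim_spectralSubspace_iff (by fun_prop)]
  have : cfc (fun s : ℝ => s - lam * s ^ 2) T = T - (lam : ℂ) • (T * T) := by
    rw [cfc_sub (fun s => s) (fun s => lam * s ^ 2) T, cfc_const_mul lam (fun s => s ^ 2) T,
      cfc_pow_id T 2, cfc_id' ℝ T, pow_two]
    rfl
  rw [this]

end SpectralSubspace

/-! ### Negative eigenvalues and finiteness of the count -/

section FiniteSpectralSubspace

variable {H : Type*} [NormedAddCommGroup H] [InnerProductSpace ℂ H]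

theorem re_inner_self (x : H) : (⟪x, x⟫_ℂ).re = ‖x‖ ^ 2 :=
  inner_self_eq_norm_sq (𝕜 := ℂ) x

variable [CompleteSpace H]

theorem eigenspace_le_spectralSubspace {T : H →L[ℂ] H} (hT : IsSelfAdjoint T) {μ : ℝ}
    (hμ : μ < 0) :
    Module.End.eigenspace (T : H →ₗ[ℂ] H) (μ : ℂ) ≤ spectralSubspace T (Set.Iio 0) := by
  intro x hx
  have hTx : T x = (μ : ℂ) • x := Module.End.mem_eigenspace_iff.1 hx
  have hid : cfc (fun t : ℝ => t) T = T := cfc_id' ℝ T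
  set p := cfc (fun t : ℝ => √t) T
  set r := cfc (fun t : ℝ => √(-t)) T
  have hTpr : ∀ y, T y = p (p y) - r (r y) := by
    intro y
    have := cfc_eq_sqrt_sub_sqrt T continuous_id' y
    rwa [hid] at this
  have hpT : p (T x) = T (p x) := by
    have h : Commute p (cfc (fun t : ℝ => t) T) := cfc_commute_cfc _ _ T
    rw [hid] at h
    exact DFunLike.congr_fun h.eq x
  -- If nonzero, `p x` would be an eigenvector for `μ < 0`, yet `r (p x) = 0` makes the form of `T`
  -- nonnegative there.
  have hpx : p x = 0 := by
    have h1 : (⟪T (p x), p x⟫_ℂ).re = ‖p (p x)‖ ^ 2 - ‖r (p x)‖ ^ 2 := by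
      have := re_inner_cfc T continuous_id' (p x)
      rwa [hid] at this
    have h2 : r (p x) = 0 := cfc_sqrt_neg_cfc_sqrt T continuous_id' x
    rw [← hpT, hTx, map_smul, inner_smul_left, Complex.conj_ofReal, Complex.re_ofReal_mul,
      re_inner_self, h2] at h1
    have h3 : ‖p x‖ ^ 2 ≤ 0 := by
      simp only [norm_zero] at h1
      nlinarith [sq_nonneg ‖p (p x)‖, sq_nonneg ‖p x‖]
    exact norm_eq_zero.1 (pow_eq_zero_iff two_ne_zero |>.1 (le_antisymm h3 (sq_nonneg _)))
  refine (mem_spectralSubspace_iff (f := fun t => √(-t)) (by fun_prop)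
    (sqrt_neg_ne_zero_iff fun t => t)).2 fun y hy => ?_
  have h4 : (μ : ℂ) * ⟪y, x⟫_ℂ = 0 := by
    rw [← inner_smul_right, ← hTx, hTpr, hpx, map_zero, zero_sub, inner_neg_right,
      ← inner_cfc_apply, hy, inner_zero_left, neg_zero]
  exact (mul_eq_zero.1 h4).resolve_left (by exact_mod_cast hμ.ne)

theorem apply_mem_spectralSubspace {T : H →L[ℂ] H} (hT : IsSelfAdjoint T) {x : H}
    (hx : x ∈ spectralSubspace T (Set.Iio 0)) : T x ∈ spectralSubspace T (Set.Iio 0) := by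
  have hU {x : H} := mem_spectralSubspace_iff (T := T) (x := x) (f := fun t => √(-t)) (by fun_prop)
    (sqrt_neg_ne_zero_iff fun t => t)
  refine hU.2 fun y hy => ?_
  have h : Commute (cfc (fun t : ℝ => √(-t)) T) (cfc (fun t : ℝ => t) T) := cfc_commute_cfc _ _ T
  rw [cfc_id' ℝ T] at h
  have hsymm := ContinuousLinearMap.isSelfAdjoint_iff_isSymmetric.1 hT
  refine (hsymm y x).symm.trans (hU.1 hx _ ?_)
  have := DFunLike.congr_fun h.eq y
  exact this.trans (by rw [mul_apply_eq_comp, hy, map_zero])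

/-- If finite, the dimension of the negative spectral subspace is the number of negative
eigenvalues. -/
theorem negEigenvalueCount_eq_negativeDim {T : H →L[ℂ] H} (hT : IsSelfAdjoint T)
    (hfin : negativeDim T ≠ ⊤) : negEigenvalueCount T = negativeDim T := by
  have hsymm := ContinuousLinearMap.isSelfAdjoint_iff_isSymmetric.1 hT
  rw [negativeDim, edim_ne_top_iff] at hfin
  rw [negEigenvalueCount, negativeDim]
  congr 1
  set E := spectralSubspace T (Set.Iio 0)
  refine le_antisymm (iSup₂_le fun μ hμ => eigenspace_le_spectralSubspace hT hμ) ?_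
  have hinv : ∀ x ∈ E, (T : H →ₗ[ℂ] H) x ∈ E := fun x hx => apply_mem_spectralSubspace hT hx
  have hres := hsymm.restrict_invariant hinv
  have htop : (⨆ μ, Module.End.eigenspace ((T : H →ₗ[ℂ] H).restrict hinv) μ) = ⊤ :=
    (Submodule.orthogonal_eq_bot_iff).1 hres.orthogonalComplement_iSup_eigenspaces_eq_bot
  rw [← Submodule.map_subtype_top E, ← htop, Submodule.map_iSup]
  refine iSup_le fun μ => ?_
  by_cases hμ : Module.End.eigenspace ((T : H →ₗ[ℂ] H).restrict hinv) μ = ⊥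
  · simp [hμ]
  refine (Module.End.eigenspace_restrict_le_eigenspace _ hinv μ).trans ?_
  have hreal : ((μ.re : ℝ) : ℂ) = μ := Complex.conj_eq_iff_re.1 (hres.conj_eigenvalue_eq_self hμ)
  obtain ⟨x, hx, hx0⟩ := Submodule.exists_mem_ne_zero_of_ne_bot hμ
  have hTx : T x = μ • (x : H) :=
    congrArg Subtype.val (Module.End.mem_eigenspace_iff.1 hx)
  have hx0' : (x : H) ≠ 0 := by simpa using hx0
  have hneg := re_inner_cfc_neg_of_mem (T := T) continuous_id' x.2 hx0'
  rw [cfc_id' ℝ T, hTx, ← hreal, inner_smul_left, Complex.conj_ofReal, Complex.re_ofReal_mul,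
    re_inner_self] at hneg
  have hlt : μ.re < 0 := by
    have := norm_pos_iff.2 hx0'
    by_contra! h
    exact hneg.not_ge (by positivity)
  rw [← hreal]
  exact le_iSup₂_of_le (f := fun (μ : ℝ) (_ : μ < 0) =>
    Module.End.eigenspace (T : H →ₗ[ℂ] H) (μ : ℂ)) μ.re hlt le_rfl

/-- If the spectral subspaces of neighbourhoods of all points of `[0, lam]` are finite
dimensional, then so is that of `(-∞, lam)`, for an operator with nonnegative inverse `T`. -/
theorem edim_spectralSubspace_inv_ne_top {T : H →L[ℂ] H} (hT : 0 ≤ T) (lam : ℝ)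
    (hfin : ∀ μ ≤ lam, ∃ ε > 0,
      edim (spectralSubspace T {s | s ≠ 0 ∧ s⁻¹ ∈ Set.Ioo (μ - ε) (μ + ε)}) ≠ ⊤) :
    edim (spectralSubspace T {s | s ≠ 0 ∧ s⁻¹ ∈ Set.Iio lam}) ≠ ⊤ := by
  choose! ε hε hfin using hfin
  obtain ⟨F, hF, hcover⟩ := (isCompact_Icc (a := 0) (b := lam)).elim_nhds_subcover
    (fun μ => Set.Ioo (μ - ε μ) (μ + ε μ))
    fun μ hμ => Ioo_mem_nhds (by linarith [hε μ hμ.2]) (by linarith [hε μ hμ.2])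
  let E : F → Submodule ℂ H := fun μ =>
    spectralSubspace T {s | s ≠ 0 ∧ s⁻¹ ∈ Set.Ioo ((μ : ℝ) - ε μ) (μ + ε μ)}
  have hEfin : ∀ μ, FiniteDimensional ℂ (E μ) := fun μ =>
    edim_ne_top_iff.1 (hfin μ (hF μ μ.2).2)
  -- The condition `|s⁻¹ - μ| < ε μ` multiplied by `s²`, which makes it continuous across `s = 0`
  -- and excludes that point.
  let f : F → ℝ → ℝ := fun μ s => max 0 (ε μ * s ^ 2 - |s - μ * s ^ 2|)
  have hf : ∀ μ, Continuous (f μ) := fun μ => by fun_prop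
  have hfU : ∀ μ s, f μ s ≠ 0 ↔ s ∈ {s : ℝ | s ≠ 0 ∧ s⁻¹ ∈ Set.Ioo ((μ : ℝ) - ε μ) (μ + ε μ)} := by
    intro μ s
    have h1 : f μ s ≠ 0 ↔ |s - μ * s ^ 2| < ε μ * s ^ 2 := by
      simp only [f, ne_eq, max_eq_left_iff, sub_nonpos, not_le]
    rw [h1, Set.mem_ofPred_eq]
    by_cases hs : s = 0
    · simp [hs]
    · have h2 : 0 < s ^ 2 := by positivity
      have h3 : s - μ * s ^ 2 = s ^ 2 * (s⁻¹ - μ) := by field_simp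
      rw [h3, abs_mul, abs_of_pos h2, mul_comm (ε _), mul_lt_mul_iff_right₀ h2, abs_lt,
        Set.mem_Ioo]
      constructor
      · exact fun h => ⟨hs, by linarith [h.1], by linarith [h.2]⟩
      · exact fun h => ⟨by linarith [h.2.1], by linarith [h.2.2]⟩
  have hle : spectralSubspace T {s | s ≠ 0 ∧ s⁻¹ ∈ Set.Iio lam} ≤ ⨆ μ, E μ := by
    rw [← Submodule.orthogonal_orthogonal (⨆ μ, E μ)]
    refine Submodule.le_orthogonal_iff_le_orthogonal.1 fun x hx => ?_
    rw [← Submodule.iInf_orthogonal, Submodule.mem_iInf] at hx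
    rw [mem_spectralSubspace_orthogonal_iff]
    intro g hg hgU
    have hcont : Continuous (∑ μ, f μ) := by
      rw [Finset.sum_fn]
      exact continuous_finsetSum _ fun μ _ => hf μ
    refine cfc_apply_eq_zero (f := ∑ μ, f μ) hcont hg ?_ ?_
    · intro s hs hgs
      have hsU : s ≠ 0 ∧ s⁻¹ < lam := by
        by_contra h
        exact hgs (hgU s h)
      have hs0 : 0 ≤ s := spectrum_nonneg_of_nonneg hT hs
      have hmem : s⁻¹ ∈ Set.Icc 0 lam := ⟨inv_nonneg.2 hs0, hsU.2.le⟩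
      obtain ⟨μ, hμ, hsμ⟩ := Set.mem_iUnion₂.1 (hcover hmem)
      have hpos : 0 < f ⟨μ, hμ⟩ s :=
        lt_of_le_of_ne (le_max_left _ _) ((hfU ⟨μ, hμ⟩ s).2 ⟨hsU.1, hsμ⟩).symm
      rw [Finset.sum_apply]
      exact (Finset.sum_pos' (f := fun i => f i s) (fun i _ => le_max_left _ _)
        ⟨⟨μ, hμ⟩, Finset.mem_univ _, hpos⟩).ne'
    · rw [cfc_sum f T Finset.univ fun i _ => (hf i).continuousOn, sum_apply]
      exact Finset.sum_eq_zero fun μ _ => (spectralSubspace_orthogonal (hf μ) (hfU μ)).1 (hx μ)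
  exact edim_ne_top_iff.2 (Submodule.finiteDimensional_of_le hle)

end FiniteSpectralSubspace

/-! ### Reduction to an embedding of Hilbert spaces -/

section Embedding

theorem inner_starProjection_of_mem {V : Type*} [NormedAddCommGroup V]
    [InnerProductSpace ℂ V] (K : Submodule ℂ V) [K.HasOrthogonalProjection] {v : V}
    (hv : v ∈ K) (u : V) : ⟪v, K.starProjection u⟫_ℂ = ⟪v, u⟫_ℂ := by
  rw [← Submodule.inner_starProjection_left_eq_right, Submodule.starProjection_eq_self_iff.2 hv]

variable {V H : Type*} [NormedAddCommGroup V] [InnerProductSpace ℂ V] [CompleteSpace V]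
  [NormedAddCommGroup H] [InnerProductSpace ℂ H] [CompleteSpace H]

open ContinuousLinearMap (adjoint)

/-- The inverse of the operator generated by the restriction of the inner product of `V` to a
closed subspace `K`, where `V` is embedded into `H` by `J`. -/
noncomputable def embeddingInverse (J : V →L[ℂ] H) (K : Submodule ℂ V)
    [K.HasOrthogonalProjection] : H →L[ℂ] H :=
  J ∘L K.starProjection ∘L adjoint J

/-- The operator in `V` of the form `⟪u, v⟫ - lam ⟪J u, J v⟫`. -/
noncomputable def shiftedFormOperator (J : V →L[ℂ] H) (lam : ℝ) : V →L[ℂ] V :=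
  ContinuousLinearMap.id ℂ V - (lam : ℂ) • (adjoint J ∘L J)

/-- `R = (T⁻¹ - lam)⁻¹`, in terms of the bounded operators `T` and `R`. -/
structure IsShiftedInverse (T R : H →L[ℂ] H) (lam : ℝ) : Prop where
  apply_eq : ∀ f, R f = T (f + (lam : ℂ) • R f)
  eq_apply : ∀ g, R (g - (lam : ℂ) • T g) = T g

/-- Symmetry of `T` on `f + lam R f` and `g + lam R g` gives that of `R`, the terms `lam ⟪R f, R g⟫`
cancelling since `lam` is real. -/
theorem IsShiftedInverse.isSelfAdjoint {T R : H →L[ℂ] H} {lam : ℝ}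
    (h : IsShiftedInverse T R lam) (hT : IsSelfAdjoint T) : IsSelfAdjoint R := by
  rw [ContinuousLinearMap.isSelfAdjoint_iff_isSymmetric] at hT ⊢
  intro f g
  have h1 : ⟪T (f + (lam : ℂ) • R f), g + (lam : ℂ) • R g⟫_ℂ
      = ⟪f + (lam : ℂ) • R f, T (g + (lam : ℂ) • R g)⟫_ℂ := hT _ _
  rw [← h.apply_eq, ← h.apply_eq, inner_add_left, inner_add_right, inner_smul_left,
    inner_smul_right, Complex.conj_ofReal] at h1
  exact add_right_cancel h1

theorem embeddingInverse_nonneg (J : V →L[ℂ] H) (K : Submodule ℂ V)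
    [K.HasOrthogonalProjection] : 0 ≤ embeddingInverse J K := by
  rw [ContinuousLinearMap.nonneg_iff_isPositive]
  exact (ContinuousLinearMap.nonneg_iff_isPositive _).1 (isStarProjection_starProjection
    (U := K)).nonneg |>.conj_adjoint J

theorem isSelfAdjoint_embeddingInverse (J : V →L[ℂ] H) (K : Submodule ℂ V)
    [K.HasOrthogonalProjection] : IsSelfAdjoint (embeddingInverse J K) :=
  (embeddingInverse_nonneg J K).isSelfAdjoint

theorem inner_shiftedFormOperator (J : V →L[ℂ] H) (lam : ℝ) (u v : V) :
    ⟪u, shiftedFormOperator J lam v⟫_ℂ = ⟪u, v⟫_ℂ - lam * ⟪J u, J v⟫_ℂ := by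
  have : shiftedFormOperator J lam v = v - (lam : ℂ) • adjoint J (J v) := rfl
  rw [this, inner_sub_right, inner_smul_right, ContinuousLinearMap.adjoint_inner_right]

theorem shiftedFormOperator_isSymmetric (J : V →L[ℂ] H) (lam : ℝ) :
    (shiftedFormOperator J lam : V →ₗ[ℂ] V).IsSymmetric := by
  intro u v
  rw [← inner_conj_symm, ContinuousLinearMap.coe_coe, inner_shiftedFormOperator,
    inner_shiftedFormOperator]
  simp

/-- The range of `P J*` is dense in the closed subspace `K`, where `P` is its projection. -/
theorem subset_closure_range_starProjection_adjoint {J : V →L[ℂ] H} (hJ : Function.Injective J)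
    (K : Submodule ℂ V) [K.HasOrthogonalProjection] :
    (K : Set V) ⊆ closure (Set.range (K.starProjection ∘L adjoint J)) := by
  have : K ≤ (LinearMap.range (K.starProjection ∘L adjoint J).toLinearMap).topologicalClosure := by
    rw [← Submodule.orthogonal_orthogonal_eq_closure]
    intro v hv
    rw [Submodule.mem_orthogonal]
    intro u hu
    have hPu : K.starProjection u = 0 := by
      apply hJ
      rw [map_zero, ← inner_self_eq_zero (𝕜 := ℂ), ← ContinuousLinearMap.adjoint_inner_left,
        ← Submodule.inner_starProjection_left_eq_right]
      exact hu _ ⟨_, rfl⟩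
    rw [← inner_conj_symm, ← inner_starProjection_of_mem K hv, hPu]
    simp
  exact this

/-- The form `⟪u, v⟫ - lam ⟪J u, J v⟫` on `K` and the counting function of the operator that
`⟪u, v⟫` generates. -/
theorem hasNegDim_embeddingInverse_iff {J : V →L[ℂ] H} (hJ : Function.Injective J)
    (K : Submodule ℂ V) [K.HasOrthogonalProjection] (lam : ℝ) {n : ℕ} :
    HasNegDim (embeddingInverse J K - (lam : ℂ) • (embeddingInverse J K * embeddingInverse J K))
      ⊤ n ↔ HasNegDim (shiftedFormOperator J lam) K n := by
  refine hasNegDim_iff_of_pullback (K.starProjection ∘L adjoint J) (fun x => ?_)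
    (fun x => K.starProjection_apply_mem _) (subset_closure_range_starProjection_adjoint hJ K)
  have hT := ContinuousLinearMap.isSelfAdjoint_iff_isSymmetric.1
    (isSelfAdjoint_embeddingInverse J K)
  have h1 : ⟪embeddingInverse J K (embeddingInverse J K x), x⟫_ℂ
      = ⟪embeddingInverse J K x, embeddingInverse J K x⟫_ℂ := hT _ _
  have h2 : ⟪embeddingInverse J K x, x⟫_ℂ
      = ⟪K.starProjection (adjoint J x), K.starProjection (adjoint J x)⟫_ℂ := by
    rw [inner_starProjection_of_mem K (K.starProjection_apply_mem _),
      ContinuousLinearMap.adjoint_inner_right]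
    rfl
  have h3 := shiftedFormOperator_isSymmetric J lam (K.starProjection (adjoint J x))
    (K.starProjection (adjoint J x))
  rw [ContinuousLinearMap.coe_coe] at h3
  rw [ContinuousLinearMap.comp_apply, h3, inner_shiftedFormOperator, ← h2, sub_apply,
    inner_sub_left, smul_apply, inner_smul_left, Complex.conj_ofReal,
    mul_apply_eq_comp, h1]
  rfl

/-! ### Form-orthogonal decomposition along `K` -/

section Decomposition

variable (J : V →L[ℂ] H) (K : Submodule ℂ V) (lam : ℝ)

/-- The orthogonal complement of `K` with respect to the form `⟪u, v⟫ - lam ⟪J u, J v⟫`. -/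
noncomputable def formOrthogonal : Submodule ℂ V := (K.map (shiftedFormOperator J lam).toLinearMap)ᗮ

variable {J K lam}

theorem mem_formOrthogonal_iff {g : V} :
    g ∈ formOrthogonal J K lam ↔ ∀ v ∈ K, ⟪v, shiftedFormOperator J lam g⟫_ℂ = 0 := by
  rw [formOrthogonal, Submodule.mem_orthogonal]
  constructor
  · exact fun h v hv => (shiftedFormOperator_isSymmetric J lam v g).symm.trans
      (h _ (Submodule.mem_map_of_mem hv))
  · rintro h _ ⟨v, hv, rfl⟩
    exact (shiftedFormOperator_isSymmetric J lam v g).trans (h v hv)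

variable [K.HasOrthogonalProjection]

variable (J K lam) in
/-- The resolvent `R`, as a map into `V`. -/
noncomputable def resolventLift (R : H →L[ℂ] H) : H →L[ℂ] V :=
  K.starProjection ∘L adjoint J ∘L (ContinuousLinearMap.id ℂ H + (lam : ℂ) • R)

variable {R : H →L[ℂ] H}

theorem resolventLift_mem (f : H) : resolventLift J K lam R f ∈ K :=
  K.starProjection_apply_mem _

theorem embed_resolventLift (h : IsShiftedInverse (embeddingInverse J K) R lam) (f : H) :
    J (resolventLift J K lam R f) = R f :=
  (h.apply_eq f).symm

/-- The weak form of `(A - lam) u = f`, tested against `K`. -/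
theorem inner_shiftedFormOperator_resolventLift
    (h : IsShiftedInverse (embeddingInverse J K) R lam) {v : V} (hv : v ∈ K) (f : H) :
    ⟪v, shiftedFormOperator J lam (resolventLift J K lam R f)⟫_ℂ = ⟪J v, f⟫_ℂ := by
  rw [inner_shiftedFormOperator, embed_resolventLift h]
  have : resolventLift J K lam R f = K.starProjection (adjoint J (f + (lam : ℂ) • R f)) := rfl
  rw [this, inner_starProjection_of_mem K hv, ContinuousLinearMap.adjoint_inner_right,
    inner_add_right, inner_smul_right, add_sub_cancel_right]

/-- Such a `v` would be an eigenvector at `lam`: it satisfies `J v = lam T (J v)`, which the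
existence of the resolvent forbids unless `v = 0`. -/
theorem eq_zero_of_mem_of_mem_formOrthogonal (hJ : Function.Injective J)
    (h : IsShiftedInverse (embeddingInverse J K) R lam) {v : V} (hv : v ∈ K)
    (hv' : v ∈ formOrthogonal J K lam) : v = 0 := by
  rw [mem_formOrthogonal_iff] at hv'
  have h1 : v = (lam : ℂ) • K.starProjection (adjoint J (J v)) := by
    have hmem : v - (lam : ℂ) • K.starProjection (adjoint J (J v)) ∈ K :=
      K.sub_mem hv (K.smul_mem _ (K.starProjection_apply_mem _))
    have h0 := hv' _ hmem
    rw [inner_shiftedFormOperator, ← ContinuousLinearMap.adjoint_inner_right,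
      ← inner_starProjection_of_mem K hmem (adjoint J _), ← inner_smul_right, ← inner_sub_right,
      inner_self_eq_zero] at h0
    exact sub_eq_zero.1 h0
  have h2 : J v - (lam : ℂ) • embeddingInverse J K (J v) = 0 := by
    conv_lhs => enter [1]; rw [h1]
    rw [map_smul]
    exact sub_self _
  have h3 := h.eq_apply (J v)
  rw [h2, map_zero] at h3
  rw [← h3, smul_zero, sub_zero] at h2
  exact hJ (by rw [h2, map_zero])

variable (J K lam R) in
/-- The projection onto the form-orthogonal complement of `K`, along `K`. -/
noncomputable def formProjection : V →L[ℂ] V :=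
  (ContinuousLinearMap.id ℂ V + (lam : ℂ) • (resolventLift J K lam R ∘L J)) ∘L
    (ContinuousLinearMap.id ℂ V - K.starProjection)

theorem sub_formProjection_mem (u : V) : u - formProjection J K lam R u ∈ K := by
  have : u - formProjection J K lam R u = K.starProjection u
      - (lam : ℂ) • resolventLift J K lam R (J (u - K.starProjection u)) := by
    have h : formProjection J K lam R u = (u - K.starProjection u)
      + (lam : ℂ) • resolventLift J K lam R (J (u - K.starProjection u)) := rfl
    rw [h]
    abel
  rw [this]
  exact K.sub_mem (K.starProjection_apply_mem _) (K.smul_mem _ (resolventLift_mem _))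

/-- For `w = u - P u`, orthogonal to `K`, only `-lam ⟪J v, J w⟫` is left of the shifted form; adding
`lam` times the lift of `J w` cancels it. -/
theorem formProjection_mem (h : IsShiftedInverse (embeddingInverse J K) R lam) (u : V) :
    formProjection J K lam R u ∈ formOrthogonal J K lam := by
  rw [mem_formOrthogonal_iff]
  intro v hv
  have : formProjection J K lam R u = (u - K.starProjection u)
      + (lam : ℂ) • resolventLift J K lam R (J (u - K.starProjection u)) := rfl
  rw [this, map_add, inner_add_right, map_smul, inner_smul_right,
    inner_shiftedFormOperator_resolventLift h hv, inner_shiftedFormOperator, inner_sub_right,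
    inner_starProjection_of_mem K hv]
  ring

/-- `u` and `g` have the same image if they differ by an element of `K` and
`g` is form-orthogonal to `K`. -/
theorem formProjection_eq (hJ : Function.Injective J)
    (h : IsShiftedInverse (embeddingInverse J K) R lam) {u g : V}
    (hg : g ∈ formOrthogonal J K lam) (hu : u - g ∈ K) : formProjection J K lam R u = g := by
  rw [← sub_eq_zero]
  refine eq_zero_of_mem_of_mem_formOrthogonal hJ h ?_
    (Submodule.sub_mem _ (formProjection_mem h u) hg)
  have := K.sub_mem hu (sub_formProjection_mem (R := R) (J := J) (lam := lam) u)
  rwa [sub_sub_sub_cancel_left] at this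

end Decomposition

/-! ### Resolvent difference and the index formula -/

variable {J : V →L[ℂ] H} {K : Submodule ℂ V} [K.HasOrthogonalProjection] {lam : ℝ}
  {RN RD : H →L[ℂ] H}

/-- The form of `RN - RD` and the form `⟪u, v⟫ - lam ⟪J u, J v⟫` on the form-orthogonal complement
of `K`. -/
theorem hasNegDim_resolvent_sub_iff (hJ : Function.Injective J)
    (hN : IsShiftedInverse (embeddingInverse J ⊤) RN lam)
    (hD : IsShiftedInverse (embeddingInverse J K) RD lam) {n : ℕ} :
    HasNegDim (RN - RD) ⊤ n ↔
      HasNegDim (shiftedFormOperator J lam) (formOrthogonal J K lam) n := by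
  set S := resolventLift J ⊤ lam RN - resolventLift J K lam RD
  have hSapp : ∀ x, S x = resolventLift J ⊤ lam RN x - resolventLift J K lam RD x := fun _ => rfl
  have hSmem : ∀ x, S x ∈ formOrthogonal J K lam := by
    intro x
    rw [mem_formOrthogonal_iff]
    intro v hv
    rw [hSapp, map_sub, inner_sub_right, inner_shiftedFormOperator_resolventLift hD hv,
      inner_shiftedFormOperator_resolventLift hN Submodule.mem_top, sub_self]
  refine hasNegDim_iff_of_pullback S (fun x => ?_) hSmem ?_
  · have h0 : J (S x) = (RN - RD) x := by
      rw [hSapp, map_sub, embed_resolventLift hN, embed_resolventLift hD]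
      rfl
    -- The Dirichlet lift lies in `K`, so pairing `S x` with itself leaves only the Neumann lift,
    -- whose weak equation yields `⟪J (S x), x⟫`.
    have h1 : ⟪S x, shiftedFormOperator J lam (resolventLift J K lam RD x)⟫_ℂ = 0 := by
      have h := mem_formOrthogonal_iff.1 (hSmem x) (resolventLift J K lam RD x) (resolventLift_mem x)
      refine (shiftedFormOperator_isSymmetric J lam _ _).symm.trans ?_
      rw [← inner_conj_symm]
      exact (congrArg _ h).trans (map_zero _)
    have h2 := inner_shiftedFormOperator_resolventLift hN
      (Submodule.mem_top : S x ∈ (⊤ : Submodule ℂ V)) x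
    have h3 : ⟪S x, shiftedFormOperator J lam (S x)⟫_ℂ = ⟪(RN - RD) x, x⟫_ℂ := by
      nth_rw 2 [hSapp]
      rw [map_sub, inner_sub_right, h1, sub_zero, h2, h0]
    rw [← h3]
    exact congrArg Complex.re (shiftedFormOperator_isSymmetric J lam (S x) (S x)).symm
  · intro g hg
    have hdense : g ∈ closure (Set.range (resolventLift J ⊤ lam RN)) := by
      have h1 := subset_closure_range_starProjection_adjoint hJ ⊤ (Submodule.mem_top (x := g))
      refine closure_mono ?_ h1
      rintro _ ⟨y, rfl⟩
      refine ⟨y - (lam : ℂ) • embeddingInverse J ⊤ y, ?_⟩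
      have h2 := hN.eq_apply y
      simp only [resolventLift, ContinuousLinearMap.comp_apply, add_apply,
        smul_apply, ContinuousLinearMap.id_apply]
      rw [h2, sub_add_cancel]
    -- The Neumann lifts are dense in `V`, and the projection along `K` sends the lift of `x` to `S
    -- x`. By continuity it maps `V` into the closure of the range of `S`, and it fixes `g`.
    have h3 := (formProjection J K lam RD).continuous.closure_preimage_subset
      (Set.range S)
    have h4 : Set.range (resolventLift J ⊤ lam RN) ⊆ formProjection J K lam RD ⁻¹' Set.range S := by
      rintro _ ⟨x, rfl⟩
      refine ⟨x, (formProjection_eq hJ hD (hSmem x) ?_).symm⟩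
      rw [hSapp, sub_sub_cancel]
      exact resolventLift_mem x
    have h5 : formProjection J K lam RD g ∈ closure (Set.range S) := h3 (closure_mono h4 hdense)
    rwa [formProjection_eq hJ hD hg (by simp)] at h5

theorem negativeDim_resolvent_sub_add (hJ : Function.Injective J)
    (hN : IsShiftedInverse (embeddingInverse J ⊤) RN lam)
    (hD : IsShiftedInverse (embeddingInverse J K) RD lam) (hR : IsSelfAdjoint (RN - RD))
    (hfin : edim (spectralSubspace (embeddingInverse J K) {s | s ≠ 0 ∧ s⁻¹ ∈ Set.Iio lam}) ≠ ⊤) :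
    negativeDim (RN - RD) +
        edim (spectralSubspace (embeddingInverse J K) {s | s ≠ 0 ∧ s⁻¹ ∈ Set.Iio lam}) =
      edim (spectralSubspace (embeddingInverse J ⊤) {s | s ≠ 0 ∧ s⁻¹ ∈ Set.Iio lam}) := by
  have hcount (K : Submodule ℂ V) [K.HasOrthogonalProjection] (n : ℕ) :=
    (natCast_le_edim_spectralSubspace_inv_iff (isSelfAdjoint_embeddingInverse J K) lam
      (n := n)).trans (hasNegDim_embeddingInverse_iff hJ K lam)
  have hneg (n : ℕ) := (natCast_le_negativeDim_iff hR (n := n)).trans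
    (hasNegDim_resolvent_sub_iff hJ hN hD)
  have hcountK := hcount K
  obtain ⟨m, hm⟩ := ENat.ne_top_iff_exists.1 hfin
  rw [← hm] at hcountK ⊢
  have hQ := shiftedFormOperator_isSymmetric J lam
  have horth : ∀ v ∈ K, ∀ g ∈ formOrthogonal J K lam, ⟪v, shiftedFormOperator J lam g⟫_ℂ = 0 :=
    fun v hv g hg => mem_formOrthogonal_iff.1 hg v hv
  refine le_antisymm (ENat.forall_natCast_le_iff_le.1 fun k hk => ?_)
    (ENat.forall_natCast_le_iff_le.1 fun k hk => ?_)
  · have h1 : ((k - m : ℕ) : ℕ∞) ≤ negativeDim (RN - RD) := by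
      rw [ENat.natCast_sub]
      exact tsub_le_iff_right.2 hk
    have h2 := HasNegDim.add hQ ((hcountK m).1 le_rfl) ((hneg _).1 h1) le_top le_top horth
    exact (hcount ⊤ k).2 (h2.mono (by omega))
  -- Testing each natural number `k` separately covers the case of an infinite Neumann count.
  · have h1 := HasNegDim.sub hQ ((hcountK m).1 le_rfl)
      (fun h => by have := (hcountK (m + 1)).2 h; norm_cast at this; omega)
      (formProjection J K lam RD).toLinearMap (formProjection_mem hD)
      sub_formProjection_mem horth ((hcount ⊤ k).1 hk)
    have h2 := (hneg _).2 h1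
    rw [ENat.natCast_sub] at h2
    exact tsub_le_iff_right.1 h2

end Embedding

/-! ### The form domain as a Hilbert space -/

namespace ClosedPositiveForm

variable {H : Type*} [NormedAddCommGroup H] [InnerProductSpace ℂ H]

/-- The form domain `H¹` as a Hilbert space with inner product `a[·,·]`. -/
def FormSpace (a : ClosedPositiveForm H) : Type _ := a.domain

variable (a : ClosedPositiveForm H)

instance : AddCommGroup a.FormSpace := inferInstanceAs (AddCommGroup a.domain)

instance : Module ℂ a.FormSpace := inferInstanceAs (Module ℂ a.domain)

variable {a} in
/-- The identity map from `FormSpace a` to the form domain. -/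
def toDomain : a.FormSpace ≃ₗ[ℂ] a.domain := LinearEquiv.refl ℂ a.domain

/-- The form as an inner product. -/
@[reducible]
noncomputable def innerCore : InnerProductSpace.Core ℂ a.FormSpace where
  inner u v := a.form (toDomain u) (toDomain v)
  conj_inner_symm u v := (a.hermitian _ _).symm
  re_inner_nonneg u := by
    obtain ⟨c, hc, h⟩ := a.pos
    exact le_trans (by positivity) (h (toDomain u))
  add_left u v w := by simp
  smul_left u v r := by simp
  definite u hu := by
    obtain ⟨c, hc, h⟩ := a.pos
    have h1 : c * ‖(toDomain u : H)‖ ^ 2 ≤ 0 := (h (toDomain u)).trans (by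
      rw [hu, Complex.zero_re])
    have h2 : ‖(toDomain u : H)‖ ^ 2 ≤ 0 := by
      by_contra! h'
      exact (mul_pos hc h').not_ge h1
    have h3 : (toDomain u : H) = 0 :=
      norm_eq_zero.1 (pow_eq_zero_iff two_ne_zero |>.1 (le_antisymm h2 (sq_nonneg _)))
    simpa using h3

noncomputable instance : NormedAddCommGroup a.FormSpace :=
  a.innerCore.toNormedAddCommGroup

noncomputable instance : InnerProductSpace ℂ a.FormSpace :=
  InnerProductSpace.ofCore a.innerCore.toCore

variable {a} in
theorem norm_sq_eq_form (u : a.FormSpace) :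
    ‖u‖ ^ 2 = (a.form (toDomain u) (toDomain u)).re :=
  (re_inner_self u).symm

/-- The embedding of `H¹` into `H`. -/
noncomputable def embedding : a.FormSpace →L[ℂ] H :=
  LinearMap.mkContinuousOfExistsBound (a.domain.subtype ∘ₗ toDomain.toLinearMap) (by
    obtain ⟨c, hc, h⟩ := a.pos
    refine ⟨(√c)⁻¹, fun u => ?_⟩
    have h1 := h (toDomain u)
    rw [← norm_sq_eq_form] at h1
    have h2 : √c * ‖(toDomain u : H)‖ ≤ ‖u‖ := by
      refine abs_le_of_sq_le_sq' ?_ (norm_nonneg _) |>.2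
      rwa [mul_pow, Real.sq_sqrt hc.le]
    rw [inv_mul_eq_div, le_div_iff₀ (Real.sqrt_pos.2 hc), mul_comm]
    exact h2)

theorem embedding_injective : Function.Injective a.embedding :=
  Subtype.val_injective.comp toDomain.injective

/-- A Cauchy sequence for the form also converges in `H`, and closedness of the form upgrades this
to convergence in the form norm. -/
instance [CompleteSpace H] : CompleteSpace a.FormSpace := by
  refine Metric.complete_of_cauchySeq_tendsto fun u hu => ?_
  obtain ⟨x, hx⟩ := cauchySeq_tendsto_of_complete
    (a.embedding.uniformContinuous.comp_cauchySeq hu)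
  obtain ⟨y, -, hy⟩ := a.closed (fun n => toDomain (u n)) x hx (fun ε hε => by
    obtain ⟨N, hN⟩ := Metric.cauchySeq_iff.1 hu (√ε) (Real.sqrt_pos.2 hε)
    refine ⟨N, fun m hm n hn => ?_⟩
    have h1 := hN m hm n hn
    rw [dist_eq_norm] at h1
    rw [← map_sub, ← norm_sq_eq_form, ← Real.sq_sqrt hε.le]
    exact pow_lt_pow_left₀ h1 (norm_nonneg _) two_ne_zero)
  refine ⟨toDomain.symm y, tendsto_iff_norm_sub_tendsto_zero.2 ?_⟩
  have h : Tendsto (fun n => ‖u n - toDomain.symm y‖ ^ 2) atTop (𝓝 0) := by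
    simpa only [norm_sq_eq_form, map_sub, LinearEquiv.apply_symm_apply] using hy
  simpa [Real.sqrt_sq (norm_nonneg _)] using h.sqrt

theorem graph_operator (a : ClosedPositiveForm H) : a.operator.graph = a.operatorGraph := by
  refine Submodule.toLinearPMap_graph_eq _ ?_
  rintro ⟨x, f⟩ ⟨u, hu, hform⟩ rfl
  have hu0 : u = 0 := Subtype.ext hu
  refine a.dense_domain.eq_zero_of_inner_right ℂ fun v hv => ?_
  rw [← hform ⟨v, hv⟩, hu0, map_zero]

/-- A subspace of `H`, intersected with `H¹`. -/
noncomputable def formSubspace (H₀ : Submodule ℂ H) : Submodule ℂ a.FormSpace :=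
  H₀.comap a.embedding.toLinearMap

variable {a} {H₀ : Submodule ℂ H}

theorem IsFormClosed.isClosed (h : a.IsFormClosed H₀) :
    IsClosed (a.formSubspace H₀ : Set a.FormSpace) := by
  refine IsSeqClosed.isClosed fun u y hu huy => ?_
  refine h (fun n => toDomain (u n)) (toDomain y) hu ?_
  have := (tendsto_iff_norm_sub_tendsto_zero.1 huy).pow 2
  simpa only [norm_sq_eq_form, map_sub, zero_pow two_ne_zero] using this

variable [CompleteSpace H]

/-- The equation `a[v, u] = (v, f)` for `v ∈ K` is a Riesz representation problem, solved uniquely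
in `K` by `P J* f`. -/
theorem mem_operatorGraph_restrict_iff (hle : H₀ ≤ a.domain) (hdense : Dense (H₀ : Set H))
    (hclosed : a.IsFormClosed H₀) [(a.formSubspace H₀).HasOrthogonalProjection] {p : H × H} :
    p ∈ (a.restrict H₀ hle hdense hclosed).operatorGraph ↔
      p.1 = embeddingInverse a.embedding (a.formSubspace H₀) p.2 := by
  set K := a.formSubspace H₀
  set w : a.FormSpace := K.starProjection (ContinuousLinearMap.adjoint a.embedding p.2) with hw
  have hwK : w ∈ K := K.starProjection_apply_mem _
  have hwform : ∀ v ∈ K, ⟪v, w⟫_ℂ = ⟪a.embedding v, p.2⟫_ℂ := fun v hv => by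
    rw [hw, inner_starProjection_of_mem K hv, ContinuousLinearMap.adjoint_inner_right]
  have hT : embeddingInverse a.embedding K p.2 = a.embedding w := rfl
  rw [hT]
  constructor
  · rintro ⟨u, hu, hform⟩
    let u' : a.FormSpace := toDomain.symm (Submodule.inclusion hle u)
    have hu' : u' ∈ K := u.2
    have h1 : ∀ v ∈ K, ⟪v, u'⟫_ℂ = ⟪a.embedding v, p.2⟫_ℂ := fun v hv => hform ⟨_, hv⟩
    have h2 : u' = w := by
      rw [← sub_eq_zero, ← inner_self_eq_zero (𝕜 := ℂ), inner_sub_right,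
        h1 _ (K.sub_mem hu' hwK), hwform _ (K.sub_mem hu' hwK), sub_self]
    rw [← h2]
    exact hu.symm
  · intro h
    exact ⟨⟨a.embedding w, hwK⟩, h.symm, fun v => hwform (toDomain.symm (Submodule.inclusion hle v)) v.2⟩

theorem mem_operatorGraph_iff {p : H × H} :
    p ∈ a.operatorGraph ↔ p.1 = embeddingInverse a.embedding ⊤ p.2 := by
  have hT : embeddingInverse a.embedding ⊤ p.2
      = a.embedding (ContinuousLinearMap.adjoint a.embedding p.2) := by
    rw [embeddingInverse, Submodule.starProjection_top]
    rfl
  rw [hT]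
  constructor
  · rintro ⟨u, hu, hform⟩
    have h : toDomain.symm u = ContinuousLinearMap.adjoint a.embedding p.2 := by
      refine ext_inner_left ℂ fun v => ?_
      rw [ContinuousLinearMap.adjoint_inner_right]
      exact hform (toDomain v)
    rw [← h]
    exact hu.symm
  · intro h
    refine ⟨toDomain (ContinuousLinearMap.adjoint a.embedding p.2), h.symm, fun v => ?_⟩
    exact ContinuousLinearMap.adjoint_inner_right a.embedding (toDomain.symm v) p.2

end ClosedPositiveForm

/-! ### Resolvents of the unbounded operators -/

section Resolvent

variable {H : Type*} [NormedAddCommGroup H] [InnerProductSpace ℂ H]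
  {A : H →ₗ.[ℂ] H} {T R : H →L[ℂ] H}

/-- The resolvents of an operator `A` with inverse `T`. -/
theorem isResolventAt_iff (hA : ∀ p : H × H, p ∈ A.graph ↔ p.1 = T p.2) {lam : ℝ} :
    IsResolventAt A lam R ↔ IsShiftedInverse T R lam := by
  constructor
  · rintro ⟨h1, h2⟩
    refine ⟨fun f => ?_, fun g => ?_⟩
    · obtain ⟨u, hu, huf⟩ := h1 f
      have h := (hA _).1 (A.mem_graph u)
      rw [sub_eq_iff_eq_add] at huf
      simp only [huf, hu] at h
      exact h
    · obtain ⟨u, hu, hg⟩ := LinearPMap.mem_graph_iff A |>.1 ((hA (T g, g)).2 rfl)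
      have h := h2 u
      simp only at hu hg
      rwa [hg, hu] at h
  · rintro ⟨h1, h2⟩
    refine ⟨fun f => ?_, fun u => ?_⟩
    · obtain ⟨u, hu, hg⟩ :=
        LinearPMap.mem_graph_iff A |>.1 ((hA (R f, f + (lam : ℂ) • R f)).2 (h1 f))
      simp only at hu hg
      exact ⟨u, hu, by rw [hg, hu, add_sub_cancel_right]⟩
    · have h : (u : H) = T (A u) := (hA _).1 (A.mem_graph u)
      have h' := h2 (A u)
      rwa [← h] at h'

theorem isResolventAt_opResolvent {z : ℂ} (hz : z ∉ opSpectrum A) :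
    IsResolventAt A z (opResolvent A z) := by
  have h : ∃ R : H →L[ℂ] H, IsResolventAt A z R := not_not.1 hz
  rw [opResolvent, dif_pos h]
  exact h.choose_spec

/-- Identifies the inverse through which spectral subspaces of `A` are defined, so that counting
functions become statements about `T`. -/
theorem opResolvent_zero (hA : ∀ p : H × H, p ∈ A.graph ↔ p.1 = T p.2) :
    opResolvent A 0 = T := by
  have h0 : IsResolventAt A ((0 : ℝ) : ℂ) T :=
    (isResolventAt_iff hA).2 ⟨fun f => by simp, fun g => by simp⟩
  rw [Complex.ofReal_zero] at h0
  have h1 := isResolventAt_opResolvent (A := A) (z := 0) (not_not.2 ⟨T, h0⟩)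
  rw [← Complex.ofReal_zero, isResolventAt_iff hA] at h1
  ext f
  simpa using h1.apply_eq f

variable [CompleteSpace H]

theorem exists_edim_ne_top_of_lt_essInf {lam μ : ℝ} (hlam : (lam : EReal) < essInf A)
    (hμ : μ ≤ lam) :
    ∃ ε > 0, edim (opSpectralSubspace A (Set.Ioo (μ - ε) (μ + ε))) ≠ ⊤ := by
  by_contra! h
  have h1 : essInf A ≤ (μ : EReal) := sInf_le ⟨μ, h, rfl⟩
  exact (hlam.trans_le h1).not_ge (EReal.coe_le_coe_iff.2 hμ)

end Resolvent

end FormOperator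

/-! ### The main theorem -/

open FormOperator in
theorem mainTheorem5 {H : Type*} [NormedAddCommGroup H] [InnerProductSpace ℂ H]
    [CompleteSpace H] [TopologicalSpace.SeparableSpace H] (hinf : ¬ FiniteDimensional ℂ H)
    (a : ClosedPositiveForm H) (H₀ : Submodule ℂ H) (hle : H₀ ≤ a.domain)
    (hdense : Dense (H₀ : Set H)) (hclosed : a.IsFormClosed H₀)
    (AN AD : H →ₗ.[ℂ] H) (hAN : AN = a.operator)
    (hAD : AD = (a.restrict H₀ hle hdense hclosed).operator)
    (lam : ℝ) (hlam : (lam : EReal) < essInf AD)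
    (hspec : (lam : ℂ) ∉ opSpectrum AN ∪ opSpectrum AD)
    (R' : H →L[ℂ] H) (hR' : R' = opResolvent AN lam - opResolvent AD lam) :
    IsSelfAdjoint R' ∧
    countingFunction AD lam ≠ ⊤ ∧
    negativeDim R' + countingFunction AD lam = countingFunction AN lam ∧
    (countingFunction AN lam ≠ ⊤ →
      negEigenvalueCount R' + countingFunction AD lam = countingFunction AN lam) := by
  have : CompleteSpace (a.formSubspace H₀) := hclosed.isClosed.completeSpace_coe
  have hgraphN : ∀ p : H × H, p ∈ AN.graph ↔ p.1 = embeddingInverse a.embedding ⊤ p.2 := by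
    intro p
    rw [hAN, ClosedPositiveForm.graph_operator, ClosedPositiveForm.mem_operatorGraph_iff]
  have hgraphD : ∀ p : H × H,
      p ∈ AD.graph ↔ p.1 = embeddingInverse a.embedding (a.formSubspace H₀) p.2 := by
    intro p
    rw [hAD, ClosedPositiveForm.graph_operator, ClosedPositiveForm.mem_operatorGraph_restrict_iff]
  rw [Set.mem_union, not_or] at hspec
  have hN := (isResolventAt_iff hgraphN).1 (isResolventAt_opResolvent hspec.1)
  have hD := (isResolventAt_iff hgraphD).1 (isResolventAt_opResolvent hspec.2)
  have hself : IsSelfAdjoint R' := by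
    rw [hR']
    exact (hN.isSelfAdjoint (isSelfAdjoint_embeddingInverse a.embedding ⊤)).sub
      (hD.isSelfAdjoint (isSelfAdjoint_embeddingInverse a.embedding (a.formSubspace H₀)))
  have hfin : countingFunction AD lam ≠ ⊤ := by
    have h := fun μ hμ => exists_edim_ne_top_of_lt_essInf (μ := μ) hlam hμ
    simp only [countingFunction, opSpectralSubspace, opResolvent_zero hgraphD] at h ⊢
    exact edim_spectralSubspace_inv_ne_top (embeddingInverse_nonneg a.embedding (a.formSubspace H₀)) lam h
  have hmain : negativeDim R' + countingFunction AD lam = countingFunction AN lam := by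
    simp only [countingFunction, opSpectralSubspace, opResolvent_zero hgraphD,
      opResolvent_zero hgraphN] at hfin ⊢
    subst hR'
    exact negativeDim_resolvent_sub_add a.embedding_injective hN hD hself hfin
  refine ⟨hself, hfin, hmain, fun hNfin => ?_⟩
  rw [negEigenvalueCount_eq_negativeDim hself, hmain]
  intro htop
  exact hNfin (by rw [← hmain, htop, top_add])
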